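/- Let $\Omega\subset\mathbb{R}^2$ be open and bounded, let $0<\gamma<1$, $s_0\ge 0$, $\kappa\ge-\gamma s_0$, and let $\rho\in C^\infty(\mathbb{R})$ satisfy $\rho(s)=0$ for $s\le 0$ and $\rho(s)=\gamma s+\kappa$ for $s\ge s_0$, and be convex on $[0,s_0]$. Let $u_0\in W^{1,2}(\Omega,\mathbb{R}^2)$ and $$\mathcal{A}_{u_0}=\{u\in W^{1,2}(\Omega,\mathbb{R}^2): u=u_0 \text{ on }\partial\Omega\},$$ where the boundary condition means $u-u_0\in W^{1,2}_0(\Omega,\mathbb{R}^2)$. Let $u\in\mathcal{A}_{u_0}$ be a stationary point of the functional $$I(u)=\int_\Omega \tfrac12|\nabla u|^2+\rho(\det\nabla u)\,dx,$$ that is, $u$ satisfies the weak Euler--Lagrange equation $$\int_\Omega\bigl(\nabla u+\rho'(\det\nabla u)\,\mathrm{cof}\,\nabla u\bigr)\cdot\nabla\varphi\,dx=0\qquad\text{for all }\varphi\in W^{1,2}_0(\Omega,\mathbb{R}^2),$$ where $A\cdot B=\sum_{i,j}A_{ij}B_{ij}$ and $\mathrm{cof}\,A=(\mathrm{adj}\,A)^T$.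 Then $u\in W^{2,2}_{\mathrm{loc}}(\Omega,\mathbb{R}^2)$. -/

import Mathlib

open MeasureTheory Set Filter Topology
open scoped ContDiff

namespace Elasticity

/-- The Euclidean plane. -/
abbrev Plane : Type := EuclideanSpace ℝ (Fin 2)

/-- The space `C_c^∞(Ω, F)` of smooth maps with compact support contained in `Ω`. -/
def IsTestFunction {F : Type*} [NormedAddCommGroup F] [NormedSpace ℝ F]
    (Ω : Set Plane) (φ : Plane → F) : Prop :=
  ContDiff ℝ ∞ φ ∧ HasCompactSupport φ ∧ tsupport φ ⊆ Ω

/-- `g` is the weak (distributional) partial derivative `∂_j f` of the scalar function `f`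
on `Ω`. -/
def HasWeakPartial (Ω : Set Plane) (j : Fin 2) (f g : Plane → ℝ) : Prop :=
  LocallyIntegrableOn f Ω ∧ LocallyIntegrableOn g Ω ∧
    ∀ φ : Plane → ℝ, IsTestFunction Ω φ →
      ∫ x in Ω, f x * fderiv ℝ φ x (EuclideanSpace.single j 1) = -∫ x in Ω, g x * φ x

/-- The scalar Sobolev space `W^{k,2}(Ω)`: the function and all its weak partial derivatives up
to order `k` are square integrable on `Ω`. -/
def MemWk2 : ℕ → Set Plane → (Plane → ℝ) → Prop
  | 0, Ω, f => MemLp f 2 (volume.restrict Ω)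
  | k + 1, Ω, f => MemLp f 2 (volume.restrict Ω) ∧
      ∀ j : Fin 2, ∃ g : Plane → ℝ, HasWeakPartial Ω j f g ∧ MemWk2 k Ω g

/-- `u ∈ W^{k,2}(Ω, ℝ²)`. -/
def MemSobolev (k : ℕ) (Ω : Set Plane) (u : Plane → Plane) : Prop :=
  ∀ i : Fin 2, MemWk2 k Ω (fun x => u x i)

/-- `u ∈ W^{k,2}_loc(Ω, ℝ²)`: `u ∈ W^{k,2}(V, ℝ²)` for every open `V` compactly contained
in `Ω`. -/
def MemSobolevLoc (k : ℕ) (Ω : Set Plane) (u : Plane → Plane) : Prop :=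
  ∀ V : Set Plane, IsOpen V → IsCompact (closure V) → closure V ⊆ Ω → MemSobolev k V u

/-- `u ∈ W^{1,2}(Ω, ℝ²)` and the matrix field `G` is its weak gradient,
`G i j = ∂_j u_i ∈ L²(Ω)`. -/
def HasSobolevGradient (Ω : Set Plane) (u : Plane → Plane)
    (G : Plane → Matrix (Fin 2) (Fin 2) ℝ) : Prop :=
  ∀ i : Fin 2, MemLp (fun x => u x i) 2 (volume.restrict Ω) ∧
    ∀ j : Fin 2, MemLp (fun x => G x i j) 2 (volume.restrict Ω) ∧
      HasWeakPartial Ω j (fun x => u x i) (fun x => G x i j)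

/-- `u ∈ W_0^{1,2}(Ω, ℝ²)`: the closure of `C_c^∞(Ω, ℝ²)` in the norm of `W^{1,2}(Ω, ℝ²)`. -/
def MemSobolevZero (Ω : Set Plane) (u : Plane → Plane) : Prop :=
  ∃ G : Plane → Matrix (Fin 2) (Fin 2) ℝ, HasSobolevGradient Ω u G ∧
    ∃ ψ : ℕ → Plane → Plane, (∀ n, IsTestFunction Ω (ψ n)) ∧
      (∀ i : Fin 2, Tendsto
        (fun n => eLpNorm (fun x => u x i - ψ n x i) 2 (volume.restrict Ω)) atTop (𝓝 0)) ∧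
      (∀ i j : Fin 2, Tendsto
        (fun n => eLpNorm
          (fun x => G x i j - fderiv ℝ (ψ n) x (EuclideanSpace.single j 1) i) 2
          (volume.restrict Ω)) atTop (𝓝 0))

/-- The admissible class `𝒜_{u₀} = {u ∈ W^{1,2}(Ω, ℝ²) : u = u₀ on ∂Ω}`; the boundary condition
means `u - u₀ ∈ W_0^{1,2}(Ω, ℝ²)`. -/
def admissibleClass (Ω : Set Plane) (u₀ : Plane → Plane) : Set (Plane → Plane) :=
  {u | MemSobolev 1 Ω u ∧ MemSobolevZero Ω (fun x => u x - u₀ x)}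

/-- The function `ρ` of the energy density `½|ξ|² + ρ(det ξ)`: it is smooth on `ℝ`, vanishes on
`(-∞, 0]`, is convex on `[0, s₀]` and equals the affine function `γ s + κ` on `[s₀, ∞)`. -/
structure IsVolumetricDensity (γ s₀ κ : ℝ) (ρ : ℝ → ℝ) : Prop where
  s₀_nonneg : 0 ≤ s₀
  κ_ge : -γ * s₀ ≤ κ
  smooth : ContDiff ℝ ∞ ρ
  eq_zero : ∀ s ≤ 0, ρ s = 0
  convex : ConvexOn ℝ (Icc 0 s₀) ρ
  eq_affine : ∀ s, s₀ ≤ s → ρ s = γ * s + κ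

/-- The cofactor matrix `cof A = (adj A)ᵀ`. -/
def cof (A : Matrix (Fin 2) (Fin 2) ℝ) : Matrix (Fin 2) (Fin 2) ℝ := A.adjugate.transpose

/-- The Frobenius inner product of matrices. -/
def frobeniusInner (A B : Matrix (Fin 2) (Fin 2) ℝ) : ℝ := ∑ i, ∑ j, A i j * B i j

/-- `u ∈ 𝒜_{u₀}` is a stationary point of `I(u) = ∫_Ω ½|∇u|² + ρ(det ∇u) dx`: it satisfies the
weak Euler-Lagrange equation
`∫_Ω (∇u + ρ'(det ∇u) cof ∇u) · ∇φ dx = 0` for all `φ ∈ W_0^{1,2}(Ω, ℝ²)`.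
Weak gradients are unique up to null sets, so `G = ∇u` and `Φ = ∇φ`. -/
def IsStationaryPoint (Ω : Set Plane) (ρ : ℝ → ℝ) (u₀ u : Plane → Plane) : Prop :=
  u ∈ admissibleClass Ω u₀ ∧
    ∃ G : Plane → Matrix (Fin 2) (Fin 2) ℝ, HasSobolevGradient Ω u G ∧
      ∀ (φ : Plane → Plane) (Φ : Plane → Matrix (Fin 2) (Fin 2) ℝ),
        MemSobolevZero Ω φ → HasSobolevGradient Ω φ Φ →
          ∫ x in Ω, frobeniusInner (G x + deriv ρ (G x).det • cof (G x)) (Φ x) = 0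

end Elasticity

/-!
Write the Euler-Lagrange equation as `div σ(∇u) = 0` with the stress `σ(A) = A + ρ'(det A) cof A`.
The hypotheses on `ρ` say that `ρ'` is monotone with `0 ≤ ρ' ≤ γ`. In dimension two `det` is a
quadratic form with `2 |det D| ≤ |D|²`, so these two facts make `σ` strongly monotone with constant
`1 - γ > 0` (`IsVolumetricDensity.stress_monotone`), and `|σ(A)| ≤ (1 + γ) |A|`. On the other hand
`σ` is not Lipschitz, since `ρ''(det A)` multiplies a quadratic expression in `A`.

Strong monotonicity and linear growth already suffice for Nirenberg's method of difference
quotients. Test the equation with `Δ₋ᵥ(η² Δᵥ u)`, where `Δᵥ f = f(· + v) - f`, `v = h eₖ`, and `η` is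
a cutoff. The leading term is at least `(1 - γ) ‖η Δᵥ∇u‖²`. In the remaining term
`∫ Δᵥσ · (∇(η²) ⊗ Δᵥ u)` the increment is moved off `σ`, so that only `‖σ‖` in `L²` enters, and
`Δ₋ᵥ(∇(η²) Δᵥ u)` is bounded by `|h|` times a derivative, that is by
`C |h| (‖η Δᵥ∇u‖ + |h| ‖∇u‖)` (`sum_integral_increment_mul_le_of_smooth`). Hence
`‖η Δᵥ∇u‖ ≤ M |h|` (`exists_l2norm_increment_le`), and weak compactness in `L²` gives the second
derivatives (`exists_hasWeakPartial_of_increment_le`).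

To work on the whole plane, `u` is replaced by `ζ u` with a cutoff `ζ` that is `1` near the support
of `η`. The calculation is carried out for mollifications of `ζ u` (`exists_smooth_approx`), whose
gradients converge in `L²`, which is all that the passage to the limit requires.
-/

namespace Elasticity

/-! ### Square integrable functions on the plane -/

/-- The norm of `L²(ℝ²)`. -/
noncomputable abbrev l2norm (f : Plane → ℝ) : ℝ := lpNorm f 2 volume

/-- The increment `x ↦ f (x + v) - f x` of `f` along `v`. -/
def increment (v : Plane) (f : Plane → ℝ) : Plane → ℝ := fun x => f (x + v) - f x

/-- Convergence of a sequence in the norm of `L²(ℝ²)`. -/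
def TendstoL2 (F : ℕ → Plane → ℝ) (f : Plane → ℝ) : Prop :=
  Tendsto (fun n => l2norm (F n - f)) atTop (𝓝 0)

theorem l2norm_sq {f : Plane → ℝ} (hf : MemLp f 2 volume) : l2norm f ^ 2 = ∫ x, f x ^ 2 := by
  rw [l2norm, lpNorm_eq_integral_norm_rpow_toReal (by simp) (by simp) hf.aestronglyMeasurable,
    ← Real.rpow_natCast, ← Real.rpow_mul (integral_nonneg fun x => by positivity)]
  simp

theorem abs_integral_mul_le {f g : Plane → ℝ} (hf : MemLp f 2 volume) (hg : MemLp g 2 volume) :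
    |∫ x, f x * g x| ≤ l2norm f * l2norm g := by
  have h := abs_real_inner_le_norm (hf.toLp f) (hg.toLp g)
  rw [L2.inner_def, Lp.norm_toLp, Lp.norm_toLp, toReal_eLpNorm hf.aestronglyMeasurable,
    toReal_eLpNorm hg.aestronglyMeasurable] at h
  convert h using 2
  refine integral_congr_ae ?_
  filter_upwards [hf.coeFn_toLp, hg.coeFn_toLp] with x hx hy
  simp [hx, hy, mul_comm]

theorem memLp_comp_add {f : Plane → ℝ} (hf : MemLp f 2 volume) (v : Plane) :
    MemLp (fun x => f (x + v)) 2 volume :=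
  hf.comp_measurePreserving (measurePreserving_add_right volume v)

theorem l2norm_comp_add {f : Plane → ℝ} (hf : MemLp f 2 volume) (v : Plane) :
    l2norm (fun x => f (x + v)) = l2norm f := by
  rw [l2norm, l2norm, ← toReal_eLpNorm (memLp_comp_add hf v).aestronglyMeasurable,
    ← toReal_eLpNorm hf.aestronglyMeasurable]
  exact congrArg _ (eLpNorm_comp_measurePreserving hf.aestronglyMeasurable
    (measurePreserving_add_right volume v))

theorem memLp_increment {f : Plane → ℝ} (hf : MemLp f 2 volume) (v : Plane) :
    MemLp (increment v f) 2 volume :=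
  (memLp_comp_add hf v).sub hf

theorem memLp_continuous_mul {η f : Plane → ℝ} {C : ℝ} (hf : MemLp f 2 volume)
    (hη : Continuous η) (hC : ∀ x, |η x| ≤ C) : MemLp (fun x => η x * f x) 2 volume :=
  hf.of_le_mul (c := C) (hη.aestronglyMeasurable.mul hf.aestronglyMeasurable)
    (ae_of_all _ fun x => by
      rw [norm_mul]; exact mul_le_mul_of_nonneg_right (hC x) (norm_nonneg _))

theorem l2norm_le_mul {f g : Plane → ℝ} {C : ℝ} (hC : 0 ≤ C)
    (hg : MemLp g 2 volume) (h : ∀ x, |f x| ≤ C * |g x|) : l2norm f ≤ C * l2norm g := by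
  have h1 : l2norm f ≤ lpNorm (C • fun x => |g x|) 2 volume :=
    lpNorm_mono_real (hg.norm.const_smul C) h
  rwa [lpNorm_const_smul, coe_nnnorm, lpNorm_fun_abs hg.aestronglyMeasurable,
    Real.norm_of_nonneg hC] at h1

theorem l2norm_bounded_mul_le {η f : Plane → ℝ} {C : ℝ} (hf : MemLp f 2 volume)
    (hC : ∀ x, |η x| ≤ C) :
    l2norm (fun x => η x * f x) ≤ C * l2norm f :=
  l2norm_le_mul ((abs_nonneg _).trans (hC 0)) hf fun x => by
    rw [abs_mul]; exact mul_le_mul_of_nonneg_right (hC x) (abs_nonneg _)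

theorem TendstoL2.of_le {F F' : ℕ → Plane → ℝ} {f f' : Plane → ℝ} (C : ℝ) (h : TendstoL2 F f)
    (hle : ∀ n, l2norm (F' n - f') ≤ C * l2norm (F n - f)) : TendstoL2 F' f' := by
  refine squeeze_zero (fun n => lpNorm_nonneg) hle ?_
  simpa using h.const_mul C

theorem TendstoL2.increment {F : ℕ → Plane → ℝ} {f : Plane → ℝ} (h : TendstoL2 F f)
    (hF : ∀ n, MemLp (F n) 2 volume) (hf : MemLp f 2 volume) (v : Plane) :
    TendstoL2 (fun n => increment v (F n)) (Elasticity.increment v f) := by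
  refine h.of_le 2 fun n => ?_
  have h1 := (hF n).sub hf
  have h2 : Elasticity.increment v (F n) - Elasticity.increment v f =
      (fun x => (F n - f) (x + v)) - (F n - f) := by
    ext x; simp [Elasticity.increment]; ring
  rw [h2]
  refine (lpNorm_sub_le (memLp_comp_add h1 v) (by norm_num)).trans ?_
  have := l2norm_comp_add h1 v
  simp only [l2norm] at this ⊢
  linarith

theorem TendstoL2.bounded_mul {F : ℕ → Plane → ℝ} {f η : Plane → ℝ} {C : ℝ}
    (h : TendstoL2 F f) (hF : ∀ n, MemLp (F n) 2 volume) (hf : MemLp f 2 volume)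
    (hC : ∀ x, |η x| ≤ C) :
    TendstoL2 (fun n x => η x * F n x) (fun x => η x * f x) := by
  refine h.of_le C fun n => ?_
  convert l2norm_bounded_mul_le ((hF n).sub hf) hC using 2
  ext x; simp [mul_sub]

theorem TendstoL2.tendsto_integral_mul {F : ℕ → Plane → ℝ} {f g : Plane → ℝ}
    (h : TendstoL2 F f) (hF : ∀ n, MemLp (F n) 2 volume) (hf : MemLp f 2 volume)
    (hg : MemLp g 2 volume) :
    Tendsto (fun n => ∫ x, g x * F n x) atTop (𝓝 (∫ x, g x * f x)) := by
  rw [tendsto_iff_norm_sub_tendsto_zero]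
  refine squeeze_zero (fun n => norm_nonneg _) (fun n => ?_)
    (by simpa using h.const_mul (l2norm g))
  have h1 : Integrable (fun x => g x * F n x) := hg.integrable_mul (hF n)
  have h2 : Integrable (fun x => g x * f x) := hg.integrable_mul hf
  rw [← integral_sub h1 h2]
  simpa [mul_sub] using abs_integral_mul_le hg ((hF n).sub hf)

theorem TendstoL2.tendsto_l2norm {F : ℕ → Plane → ℝ} {f : Plane → ℝ}
    (h : TendstoL2 F f) (hF : ∀ n, MemLp (F n) 2 volume) (hf : MemLp f 2 volume) :
    Tendsto (fun n => l2norm (F n)) atTop (𝓝 (l2norm f)) := by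
  rw [tendsto_iff_norm_sub_tendsto_zero]
  refine squeeze_zero (fun n => norm_nonneg _) (fun n => ?_) h
  rw [Real.norm_eq_abs, abs_sub_le_iff]
  have h1 := lpNorm_le_lpNorm_add_lpNorm_sub' (f := F n) hf (by norm_num)
  have h2 := lpNorm_le_lpNorm_add_lpNorm_sub (f := f) (hF n) (by norm_num)
  simp only [l2norm]
  constructor <;> linarith

/-! ### Minkowski's inequality, difference quotients and mollification -/

theorem eLpNorm_two_sq {α : Type*} [MeasurableSpace α] (μ : Measure α) (f : α → ℝ) :
    eLpNorm f 2 μ ^ 2 = ∫⁻ x, ‖f x‖ₑ ^ 2 ∂μ := by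
  have h := eLpNorm_nnreal_pow_eq_lintegral (μ := μ) (f := f) (p := 2) (by norm_num)
  simpa using h

/-- Minkowski's inequality for averages: the `L²` norm of an average of functions is at most the
supremum of their `L²` norms. -/
theorem eLpNorm_integral_le {Y : Type*} [MeasurableSpace Y] (μ : Measure Y)
    [IsProbabilityMeasure μ] {F : Plane → Y → ℝ} {C : ENNReal}
    (hF : AEStronglyMeasurable (Function.uncurry F) (volume.prod μ))
    (hC : ∀ᵐ y ∂μ, eLpNorm (fun x => F x y) 2 volume ≤ C) :
    eLpNorm (fun x => ∫ y, F x y ∂μ) 2 volume ≤ C := by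
  rw [← ENNReal.pow_le_pow_left_iff (n := 2) (by norm_num), eLpNorm_two_sq]
  calc ∫⁻ x, ‖∫ y, F x y ∂μ‖ₑ ^ 2
      ≤ ∫⁻ x, ∫⁻ y, ‖F x y‖ₑ ^ 2 ∂μ := by
        refine lintegral_mono_ae ?_
        filter_upwards [hF.prodMk_left] with x hx
        rw [← eLpNorm_two_sq]
        gcongr
        refine (enorm_integral_le_lintegral_enorm _).trans ?_
        rw [← eLpNorm_one_eq_lintegral_enorm]
        exact eLpNorm_le_eLpNorm_of_exponent_le (by norm_num) hx
    _ = ∫⁻ y, (∫⁻ x, ‖F x y‖ₑ ^ 2) ∂μ := lintegral_lintegral_swap (hF.enorm.pow_const 2)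
    _ ≤ ∫⁻ _, C ^ 2 ∂μ := by
        refine lintegral_mono_ae ?_
        filter_upwards [hC] with y hy
        rw [← eLpNorm_two_sq]
        gcongr
    _ = C ^ 2 := by simp

/-- The partial derivative `∂_j f`. -/
noncomputable def partialDeriv (j : Fin 2) (f : Plane → ℝ) : Plane → ℝ :=
  fun x => fderiv ℝ f x (EuclideanSpace.single j 1)

theorem contDiff_partialDeriv {f : Plane → ℝ} (hf : ContDiff ℝ ∞ f) (j : Fin 2) :
    ContDiff ℝ ∞ (partialDeriv j f) :=
  (hf.fderiv_right (m := ∞) (by simp)).clm_apply contDiff_const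

theorem tsupport_partialDeriv_subset (f : Plane → ℝ) (j : Fin 2) :
    tsupport (partialDeriv j f) ⊆ tsupport f :=
  closure_minimal ((fun x hx => (support_fderiv_subset ℝ (f := f)) (by
    simp only [Function.mem_support, partialDeriv] at hx ⊢
    intro h; simp [h] at hx))) (isClosed_tsupport f)

theorem hasCompactSupport_partialDeriv {f : Plane → ℝ} (hf : HasCompactSupport f) (j : Fin 2) :
    HasCompactSupport (partialDeriv j f) :=
  hf.of_isClosed_subset (isClosed_tsupport _) (tsupport_partialDeriv_subset f j)

/-- The increment of a smooth function is dominated by its directional derivative in `L²`. -/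
theorem eLpNorm_increment_le {z : Plane → ℝ} (hz : ContDiff ℝ ∞ z) (v : Plane) :
    eLpNorm (increment v z) 2 volume ≤ eLpNorm (fun x => fderiv ℝ z x v) 2 volume := by
  have hcont : Continuous (fun x => fderiv ℝ z x v) :=
    (hz.continuous_fderiv (by simp)).clm_apply continuous_const
  have : IsProbabilityMeasure (volume.restrict (Ioc (0 : ℝ) 1)) := ⟨by simp⟩
  have hrep : increment v z =
      fun x => ∫ t in Ioc (0 : ℝ) 1, fderiv ℝ z (x + t • v) v := by
    ext x
    rw [← intervalIntegral.integral_of_le zero_le_one]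
    rw [intervalIntegral.integral_eq_sub_of_hasDerivAt (f := fun t : ℝ => z (x + t • v))]
    · simp [increment]
    · intro t _
      have h1 : HasDerivAt (fun t : ℝ => x + t • v) v t := by
        simpa using ((hasDerivAt_id t).smul_const v).const_add x
      exact ((hz.differentiable (by simp)) (x + t • v)).hasFDerivAt.comp_hasDerivAt t h1
    · exact (hcont.comp (by fun_prop)).intervalIntegrable _ _
  rw [hrep]
  refine eLpNorm_integral_le _ (F := fun x t => fderiv ℝ z (x + t • v) v) ?_
    (ae_of_all _ fun t => ?_)
  · exact (hcont.comp (by fun_prop : Continuous fun p : Plane × ℝ => p.1 + p.2 • v)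
      ).aestronglyMeasurable
  · exact (eLpNorm_comp_measurePreserving (g := fun x => fderiv ℝ z x v)
      hcont.aestronglyMeasurable (measurePreserving_add_right volume (t • v))).le

theorem l2norm_increment_le {z : Plane → ℝ} (hz : ContDiff ℝ ∞ z) (hc : HasCompactSupport z)
    (j : Fin 2) (h : ℝ) :
    l2norm (increment (h • EuclideanSpace.single j 1) z) ≤ |h| * l2norm (partialDeriv j z) := by
  have hd := (contDiff_partialDeriv hz j).continuous.memLp_of_hasCompactSupport
    (p := 2) (μ := volume) (hasCompactSupport_partialDeriv hc j)
  have hz2 := hz.continuous.memLp_of_hasCompactSupport (p := 2) (μ := volume) hc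
  have h1 := eLpNorm_increment_le hz (h • EuclideanSpace.single j 1)
  have h2 : (fun x => fderiv ℝ z x (h • EuclideanSpace.single j 1)) = h • partialDeriv j z := by
    ext x; simp [partialDeriv]
  rw [h2] at h1
  have h3 := ENNReal.toReal_mono (hd.const_smul h).eLpNorm_ne_top h1
  rw [toReal_eLpNorm (memLp_increment hz2 _).aestronglyMeasurable,
    toReal_eLpNorm (hd.const_smul h).aestronglyMeasurable, lpNorm_const_smul, coe_nnnorm] at h3
  exact h3

theorem tendsto_eLpNorm_increment {f : Plane → ℝ} (hf : MemLp f 2 volume) :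
    Tendsto (fun v => eLpNorm (increment v f) 2 volume) (𝓝 0) (𝓝 0) := by
  let g : C(Plane, C(Plane, Plane)) :=
    (ContinuousMap.mk (fun p : Plane × Plane => p.2 + p.1) (by fun_prop)).curry
  have hg : ∀ v, MeasurePreserving (g v) volume volume := fun v =>
    measurePreserving_add_right volume v
  have h := (continuous_const (y := hf.toLp f)).compMeasurePreservingLp g.continuous hg
    (by simp) |>.tendsto 0
  have h0 : Lp.compMeasurePreserving (g 0) (hg 0) (hf.toLp f) = hf.toLp f := by
    refine Lp.ext ((Lp.coeFn_compMeasurePreserving _ _).trans ?_)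
    have : (g 0 : Plane → Plane) = id := by ext1 x; simp [g]
    rw [this]; rfl
  rw [h0, tendsto_iff_edist_tendsto_0] at h
  refine h.congr fun v => ?_
  rw [Lp.edist_def]
  refine eLpNorm_congr_ae ?_
  filter_upwards [Lp.coeFn_compMeasurePreserving (hf.toLp f) (hg v), hf.coeFn_toLp,
    (hg v).quasiMeasurePreserving.ae hf.coeFn_toLp] with x h1 h2 h3
  simp only [Pi.sub_apply, h1, h2, Function.comp, h3, increment]
  rfl

/-- The `L²` distance between `f` and its average with weight `ψ` is at most the largest `L²` norm
of an increment of `f` occurring in the average. -/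
theorem eLpNorm_average_sub_le {f ψ : Plane → ℝ} (hf : MemLp f 2 volume) (hψ : Continuous ψ)
    (hψc : HasCompactSupport ψ) (hψ0 : ∀ y, 0 ≤ ψ y) (hψ1 : ∫ y, ψ y = 1) {C : ENNReal}
    (hC : ∀ y ∈ Function.support ψ, eLpNorm (increment (-y) f) 2 volume ≤ C) :
    eLpNorm (fun x => (∫ y, ψ y * f (x - y)) - f x) 2 volume ≤ C := by
  have hint : Integrable ψ := hψ.integrable_of_hasCompactSupport hψc
  have hm : Measurable fun y => ENNReal.ofReal (ψ y) := hψ.measurable.ennreal_ofReal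
  let μ : Measure Plane := volume.withDensity fun y => ENNReal.ofReal (ψ y)
  have : IsProbabilityMeasure μ := ⟨by
    rw [withDensity_apply _ MeasurableSet.univ, Measure.restrict_univ,
      ← ofReal_integral_eq_lintegral_ofReal hint (ae_of_all _ hψ0), hψ1, ENNReal.ofReal_one]⟩
  have hloc : LocallyIntegrable f volume := hf.locallyIntegrable (by norm_num)
  have hrep : (fun x => (∫ y, ψ y * f (x - y)) - f x) =
      fun x => ∫ y, increment (-y) f x ∂μ := by
    ext x
    have hi : Integrable (fun y => ψ y * f (x - y)) :=
      hψc.convolutionExists_left (ContinuousLinearMap.lsmul ℝ ℝ) hψ hloc x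
    rw [integral_withDensity_eq_integral_toReal_smul hm (ae_of_all _ fun _ => ENNReal.ofReal_lt_top)]
    have h1 : ∀ y, (ENNReal.ofReal (ψ y)).toReal • increment (-y) f x =
        ψ y * f (x - y) - ψ y * f x := fun y => by
      rw [ENNReal.toReal_ofReal (hψ0 y)]; simp [increment, sub_eq_add_neg]; ring
    simp_rw [h1]
    rw [integral_sub hi (hint.mul_const _), integral_mul_const, hψ1, one_mul]
  rw [hrep]
  refine eLpNorm_integral_le μ (F := fun x y => increment (-y) f x) ?_ ?_
  · have hac : (volume : Measure Plane).prod μ ≪ (volume : Measure Plane).prod volume :=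
      Measure.AbsolutelyContinuous.rfl.prod (withDensity_absolutelyContinuous _ _)
    refine AEStronglyMeasurable.mono_ac hac (.sub ?_ ?_)
    · exact hf.aestronglyMeasurable.comp_quasiMeasurePreserving
        (by simpa [sub_eq_add_neg] using
          quasiMeasurePreserving_sub_of_right_invariant (volume : Measure Plane) volume)
    · exact hf.aestronglyMeasurable.comp_quasiMeasurePreserving Measure.quasiMeasurePreserving_fst
  · rw [ae_withDensity_iff hm]
    refine ae_of_all _ fun y hy => hC y fun h => hy (by simp [h])

/-- Mollification turns weak derivatives into classical ones. -/
theorem HasWeakPartial.partialDeriv_average {w g ψ : Plane → ℝ} {j : Fin 2}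
    (hw : HasWeakPartial univ j w g) (hψ : ContDiff ℝ ∞ ψ) (hψc : HasCompactSupport ψ) :
    partialDeriv j (fun x => ∫ y, ψ y * w (x - y)) = fun x => ∫ y, ψ y * g (x - y) := by
  ext x
  have hloc : LocallyIntegrable w volume := locallyIntegrableOn_univ.1 hw.1
  have hd := hψc.hasFDerivAt_convolution_left (ContinuousLinearMap.lsmul ℝ ℝ) (μ := volume)
    (hψ.of_le (by simp)) hloc x
  have he : (convolution ψ w (ContinuousLinearMap.lsmul ℝ ℝ) volume) =
      fun x => ∫ y, ψ y * w (x - y) := rfl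
  rw [he] at hd
  have hex := (hψc.fderiv ℝ).convolutionExists_left
    ((ContinuousLinearMap.lsmul ℝ ℝ : ℝ →L[ℝ] ℝ →L[ℝ] ℝ).precompL Plane) (μ := volume)
    (hψ.continuous_fderiv (by simp)) hloc x
  rw [partialDeriv, hd.fderiv, convolution, ContinuousLinearMap.integral_apply hex]
  simp only [ContinuousLinearMap.precompL_apply, ContinuousLinearMap.lsmul_apply, smul_eq_mul]
  -- the weak derivative of `w` is tested with the reflected kernel
  let φ : Plane → ℝ := fun y => ψ (x - y)
  have hφ : IsTestFunction univ φ :=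
    ⟨hψ.comp (contDiff_const.sub contDiff_id),
      hψc.comp_homeomorph (Homeomorph.subLeft x), subset_univ _⟩
  have hφd : ∀ y, fderiv ℝ φ y (EuclideanSpace.single j 1) =
      -fderiv ℝ ψ (x - y) (EuclideanSpace.single j 1) := fun y => by
    have h1 : HasFDerivAt (fun y : Plane => x - y) (-ContinuousLinearMap.id ℝ Plane) y :=
      (hasFDerivAt_id y).const_sub x
    have h2 := ((hψ.differentiable (by simp)) (x - y)).hasFDerivAt.comp y h1
    have h3 : fderiv ℝ φ y = _ := h2.fderiv
    rw [h3]; simp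
  have h := hw.2.2 φ hφ
  simp only [Measure.restrict_univ, hφd, mul_neg, integral_neg, neg_inj] at h
  rw [← integral_sub_left_eq_self _ volume x, ← integral_sub_left_eq_self (fun y => ψ y * _) volume x]
  simpa [φ, mul_comm] using h

/-- A compactly supported function in `W^{1,2}(ℝ²)` is approximated by test functions whose
gradients converge in `L²`. -/
theorem exists_smooth_approx {w : Plane → ℝ} {H : Fin 2 → Plane → ℝ} (hwc : HasCompactSupport w)
    (hH : ∀ j, MemLp (H j) 2 volume) (hw : ∀ j, HasWeakPartial univ j w (H j)) :
    ∃ W : ℕ → Plane → ℝ, (∀ n, ContDiff ℝ ∞ (W n) ∧ HasCompactSupport (W n)) ∧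
      ∀ j, TendstoL2 (fun n => partialDeriv j (W n)) (H j) := by
  let b : ℕ → ContDiffBump (0 : Plane) := fun n =>
    ⟨1 / (n + 2), 1 / (n + 1), by positivity, by gcongr; norm_num⟩
  let ψ : ℕ → Plane → ℝ := fun n => (b n).normed volume
  have hψ : ∀ n, ContDiff ℝ ∞ (ψ n) := fun n => (b n).contDiff_normed
  have hψc : ∀ n, HasCompactSupport (ψ n) := fun n => (b n).hasCompactSupport_normed
  have hloc : LocallyIntegrable w volume := locallyIntegrableOn_univ.1 (hw 0).1
  have hsmooth : ∀ n, ContDiff ℝ ∞ (fun x => ∫ y, ψ n y * w (x - y)) := fun n =>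
    (hψc n).contDiff_convolution_left (ContinuousLinearMap.lsmul ℝ ℝ) (hψ n) hloc
  refine ⟨fun n x => ∫ y, ψ n y * w (x - y), fun n => ⟨hsmooth n,
    (hψc n).convolution (ContinuousLinearMap.lsmul ℝ ℝ) hwc⟩, fun j => ?_⟩
  have hlim : Tendsto (fun n => eLpNorm (partialDeriv j (fun x => ∫ y, ψ n y * w (x - y)) - H j)
      2 volume) atTop (𝓝 0) := by
    rw [ENNReal.tendsto_atTop_zero]
    intro ε hε
    obtain ⟨δ, hδ, hδε⟩ := Metric.eventually_nhds_iff.1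
      ((tendsto_eLpNorm_increment (hH j)).eventually (ge_mem_nhds hε))
    obtain ⟨N, hN⟩ := exists_nat_one_div_lt hδ
    refine ⟨N, fun n hn => ?_⟩
    rw [(hw j).partialDeriv_average (hψ n) (hψc n)]
    refine eLpNorm_average_sub_le (hH j) (hψ n).continuous (hψc n)
      (fun y => (b n).nonneg_normed y) ((b n).integral_normed) fun y hy => hδε ?_
    rw [(b n).support_normed_eq, mem_ball_zero_iff] at hy
    rw [dist_zero_right, norm_neg]
    refine hy.trans (lt_of_le_of_lt ?_ hN)
    exact Nat.one_div_le_one_div hn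
  rw [TendstoL2]
  have := (ENNReal.tendsto_toReal ENNReal.zero_ne_top).comp hlim
  refine this.congr fun n => ?_
  exact toReal_eLpNorm ((contDiff_partialDeriv (hsmooth n) j).continuous.aestronglyMeasurable.sub
    (hH j).aestronglyMeasurable)

/-! ### Weak derivatives from bounded difference quotients -/

theorem IsTestFunction.mono {F : Type*} [NormedAddCommGroup F] [NormedSpace ℝ F]
    {Ω Ω' : Set Plane} {φ : Plane → F} (h : IsTestFunction Ω φ) (hs : Ω ⊆ Ω') :
    IsTestFunction Ω' φ := ⟨h.1, h.2.1, h.2.2.trans hs⟩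

theorem IsTestFunction.memLp {Ω : Set Plane} {φ : Plane → ℝ} (h : IsTestFunction Ω φ) :
    MemLp φ 2 volume :=
  h.1.continuous.memLp_of_hasCompactSupport h.2.1

theorem IsTestFunction.partialDeriv {Ω : Set Plane} {φ : Plane → ℝ} (h : IsTestFunction Ω φ)
    (j : Fin 2) : IsTestFunction Ω (partialDeriv j φ) :=
  ⟨contDiff_partialDeriv h.1 j, hasCompactSupport_partialDeriv h.2.1 j,
    (tsupport_partialDeriv_subset φ j).trans h.2.2⟩

theorem IsTestFunction.mul {Ω : Set Plane} {φ ψ : Plane → ℝ} (h : IsTestFunction Ω φ)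
    (hψ : ContDiff ℝ ∞ ψ) : IsTestFunction Ω (fun x => φ x * ψ x) :=
  ⟨h.1.mul hψ, h.2.1.mul_right, (tsupport_mul_subset_left).trans h.2.2⟩

theorem IsTestFunction.exists_bound {Ω : Set Plane} {φ : Plane → ℝ} (h : IsTestFunction Ω φ) :
    ∃ C, ∀ x, |φ x| ≤ C := by
  simpa using h.2.1.exists_bound_of_continuous h.1.continuous

theorem IsTestFunction.eq_zero {F : Type*} [NormedAddCommGroup F] [NormedSpace ℝ F]
    {Ω : Set Plane} {φ : Plane → F} (h : IsTestFunction Ω φ) {x : Plane} (hx : x ∉ Ω) :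
    φ x = 0 :=
  image_eq_zero_of_notMem_tsupport fun h' => hx (h.2.2 h')

/-- Summation by parts for increments. -/
theorem integral_increment_mul {f g : Plane → ℝ} (hf : MemLp f 2 volume) (hg : MemLp g 2 volume)
    (v : Plane) : ∫ x, increment v f x * g x = ∫ x, f x * increment (-v) g x := by
  have h1 : Integrable fun x => f (x + v) * g x := (memLp_comp_add hf v).integrable_mul hg
  have h2 : Integrable fun x => f x * g (x + -v) := hf.integrable_mul (memLp_comp_add hg (-v))
  have h3 : Integrable fun x => f x * g x := hf.integrable_mul hg
  simp only [increment, sub_mul, mul_sub]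
  rw [integral_sub h1 h3, integral_sub h2 h3,
    ← integral_add_right_eq_self (fun x => f x * g (x + -v)) v]
  simp

theorem tendsto_integral_mul_differenceQuotient {f φ : Plane → ℝ} (hf : MemLp f 2 volume)
    (hφ : IsTestFunction univ φ) (k : Fin 2) :
    Tendsto (fun h : ℝ => ∫ x, f x * (h⁻¹ * increment (-(h • EuclideanSpace.single k 1)) φ x))
      (𝓝[>] 0) (𝓝 (-∫ x, f x * fderiv ℝ φ x (EuclideanSpace.single k 1))) := by
  obtain ⟨L, hL⟩ := hφ.1.lipschitzWith_of_hasCompactSupport hφ.2.1 (by simp)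
  set K := Metric.cthickening 1 (tsupport φ) with hK
  have hKc : IsCompact K := IsCompact.cthickening hφ.2.1
  have hfK : IntegrableOn f K := (hf.locallyIntegrable (by norm_num)).integrableOn_isCompact hKc
  rw [← integral_neg]
  refine tendsto_integral_filter_of_dominated_convergence (K.indicator fun x => L * |f x|)
    ?_ ?_ ?_ ?_
  · refine Eventually.of_forall fun h => hf.aestronglyMeasurable.mul ?_
    exact ((memLp_increment hφ.memLp _).const_mul _).aestronglyMeasurable
  · have h1 : ∀ᶠ h : ℝ in 𝓝[>] 0, h ∈ Ioo (0 : ℝ) 1 := Ioo_mem_nhdsGT one_pos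
    filter_upwards [h1] with h hh
    refine ae_of_all _ fun x => ?_
    by_cases hx : x ∈ K
    · rw [indicator_of_mem hx, norm_mul, norm_mul, mul_comm (L : ℝ), Real.norm_eq_abs]
      gcongr
      have := hL.norm_sub_le (x + -(h • EuclideanSpace.single k 1)) x
      rw [increment, norm_inv, Real.norm_of_nonneg hh.1.le, inv_mul_le_iff₀ hh.1]
      refine this.trans ?_
      simp [norm_smul, abs_of_pos hh.1, mul_comm]
    · rw [indicator_of_notMem hx]
      have hz : ∀ y, ‖y - x‖ ≤ 1 → φ y = 0 := fun y hy => by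
        refine image_eq_zero_of_notMem_tsupport fun hy' => hx ?_
        exact Metric.mem_cthickening_of_dist_le x y 1 _ hy' (by rwa [dist_comm, dist_eq_norm])
      rw [increment, hz x (by simp), hz _ (by simpa [norm_smul, abs_of_pos hh.1] using hh.2.le)]
      simp
  · exact (IntegrableOn.integrable_indicator (hfK.abs.const_mul _) hKc.measurableSet)
  · refine ae_of_all _ fun x => ?_
    rw [← mul_neg]
    refine Tendsto.const_mul _ ?_
    have h1 : HasDerivAt (fun t : ℝ => x + -(t • EuclideanSpace.single k (1 : ℝ)))
        (-(EuclideanSpace.single k (1 : ℝ))) 0 := by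
      simpa using (((hasDerivAt_id (0 : ℝ)).smul_const (EuclideanSpace.single k (1 : ℝ))).neg).const_add x
    have h2 : HasFDerivAt φ (fderiv ℝ φ x) (x + -((0 : ℝ) • EuclideanSpace.single k (1 : ℝ))) := by
      simpa using ((hφ.1.differentiable (by simp)) x).hasFDerivAt
    have h3 := (h2.comp_hasDerivAt (0 : ℝ) h1).tendsto_slope_zero_right
    simpa [increment, Function.comp_def] using h3

/-- An `L²` function whose difference quotients in direction `k` are bounded in `L²` near `V` has a
weak derivative `∂_k` in `L²` on `V`: a weak cluster point of the difference quotients. -/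
theorem exists_hasWeakPartial_of_increment_le {f η : Plane → ℝ} {M δ : ℝ} {V : Set Plane}
    {k : Fin 2} (hf : MemLp f 2 volume) (hη : IsTestFunction univ η) (hδ : 0 < δ)
    (hM : ∀ h : ℝ, |h| < δ →
      l2norm (fun x => η x * increment (h • EuclideanSpace.single k 1) f x) ≤ M * |h|)
    (hηV : ∀ x ∈ V, η x = 1) :
    ∃ g, MemLp g 2 volume ∧ HasWeakPartial V k f g := by
  obtain ⟨C, hC⟩ := hη.exists_bound
  have hmem : ∀ h : ℝ, MemLp (fun x => h⁻¹ * (η x *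
      increment (h • EuclideanSpace.single k 1) f x)) 2 volume := fun h =>
    (memLp_continuous_mul (memLp_increment hf _) hη.1.continuous hC).const_mul _
  let T : ℝ → WeakDual ℝ (Lp ℝ 2 (volume : Measure Plane)) := fun h =>
    StrongDual.toWeakDual (InnerProductSpace.toDual ℝ _ ((hmem h).toLp _))
  have hTK : ∀ᶠ h in 𝓝[>] (0 : ℝ), T h ∈ WeakDual.toStrongDual ⁻¹' Metric.closedBall
      (0 : StrongDual ℝ (Lp ℝ 2 (volume : Measure Plane))) M := by
    filter_upwards [Ioo_mem_nhdsGT hδ] with h hh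
    have hh' : |h| = h := abs_of_pos hh.1
    have h1 := hM h (by rw [hh']; exact hh.2)
    simp only [mem_preimage, mem_closedBall_zero_iff]
    change ‖InnerProductSpace.toDual ℝ _ ((hmem h).toLp _)‖ ≤ M
    rw [LinearIsometryEquiv.norm_map, Lp.norm_toLp, toReal_eLpNorm (hmem h).aestronglyMeasurable]
    have h2 : lpNorm (h⁻¹ • fun x => η x * increment (h • EuclideanSpace.single k 1) f x) 2 volume
        ≤ M := by
      rw [lpNorm_const_smul, coe_nnnorm, norm_inv, Real.norm_eq_abs, hh', inv_mul_le_iff₀ hh.1,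
        mul_comm]
      rwa [hh'] at h1
    exact h2
  -- an ultrafilter in place of a subsequence: the closed ball is compact for the weak topology
  let u : Ultrafilter ℝ := Ultrafilter.of (𝓝[>] 0)
  have hu : (u : Filter ℝ) ≤ 𝓝[>] 0 := Ultrafilter.of_le _
  obtain ⟨ℓ, -, hℓ⟩ := (WeakDual.isCompact_closedBall (𝕜 := ℝ) (0 : StrongDual ℝ (Lp ℝ 2
    (volume : Measure Plane))) M).ultrafilter_le_nhds (u.map T)
      (le_principal_iff.2 (hu hTK))
  have hev : ∀ φ, Tendsto (fun h => T h φ) u (𝓝 (ℓ φ)) := fun φ =>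
    ((WeakDual.eval_continuous φ).tendsto ℓ).comp hℓ
  let g := (InnerProductSpace.toDual ℝ (Lp ℝ 2 (volume : Measure Plane))).symm
    (WeakDual.toStrongDual ℓ)
  refine ⟨g, Lp.memLp g, (hf.locallyIntegrable (by norm_num)).locallyIntegrableOn _,
    ((Lp.memLp g).locallyIntegrable (by norm_num)).locallyIntegrableOn _, fun φ hφ => ?_⟩
  have hφV : ∀ x, x ∉ V → φ x = 0 := fun x hx => hφ.eq_zero hx
  rw [setIntegral_eq_integral_of_forall_compl_eq_zero fun x hx => by
      have := (hφ.partialDeriv k).eq_zero hx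
      rw [Elasticity.partialDeriv] at this
      rw [this, mul_zero],
    setIntegral_eq_integral_of_forall_compl_eq_zero fun x hx => by rw [hφV x hx, mul_zero]]
  have h1 := hev (hφ.memLp.toLp φ)
  have h2 := (tendsto_integral_mul_differenceQuotient hf (hφ.mono (subset_univ V)) k).mono_left hu
  have hT : ∀ h, T h (hφ.memLp.toLp φ) =
      ∫ x, f x * (h⁻¹ * increment (-(h • EuclideanSpace.single k 1)) φ x) := fun h => by
    have h3 : T h (hφ.memLp.toLp φ) = inner ℝ ((hmem h).toLp _) (hφ.memLp.toLp φ) := rfl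
    rw [h3, L2.inner_def]
    have h4 : ∫ x, inner ℝ ((hmem h).toLp _ x) (hφ.memLp.toLp φ x) =
        ∫ x, h⁻¹ * (increment (h • EuclideanSpace.single k 1) f x * φ x) := by
      refine integral_congr_ae ?_
      filter_upwards [(hmem h).coeFn_toLp, hφ.memLp.coeFn_toLp] with x hx hy
      rw [hx, hy]
      by_cases hxV : x ∈ V
      · simp [hηV x hxV]; ring
      · simp [hφV x hxV]
    rw [h4, integral_const_mul, integral_increment_mul hf hφ.memLp, ← integral_const_mul]
    congr 1; ext x; ring
  simp_rw [hT] at h1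
  have h5 := tendsto_nhds_unique h1 h2
  have h6 : ℓ (hφ.memLp.toLp φ) = ∫ x, g x * φ x := by
    have h7 : ℓ (hφ.memLp.toLp φ) = inner ℝ g (hφ.memLp.toLp φ) := by
      rw [InnerProductSpace.toDual_symm_apply]; rfl
    rw [h7, L2.inner_def]
    refine integral_congr_ae ?_
    filter_upwards [hφ.memLp.coeFn_toLp] with x hy
    rw [hy]; simp [mul_comm]
  rw [← h6, h5, neg_neg]

/-! ### The difference quotient estimate for monotone systems -/

theorem partialDeriv_mul {f g : Plane → ℝ} (hf : ContDiff ℝ ∞ f) (hg : ContDiff ℝ ∞ g)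
    (j : Fin 2) (x : Plane) : partialDeriv j (fun x => f x * g x) x =
      partialDeriv j f x * g x + f x * partialDeriv j g x := by
  rw [partialDeriv, fderiv_fun_mul (hf.differentiable (by simp) x) (hg.differentiable (by simp) x)]
  simp [partialDeriv]; ring

theorem partialDeriv_increment {f : Plane → ℝ} (hf : ContDiff ℝ ∞ f) (j : Fin 2) (v : Plane) :
    partialDeriv j (increment v f) = increment v (partialDeriv j f) := by
  ext x
  have h1 : DifferentiableAt ℝ (fun x => f (x + v)) x :=
    (hf.differentiable (by simp) (x + v)).comp x (differentiableAt_id.add_const v)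
  have h2 : increment v f = fun x => f (x + v) - f x := rfl
  rw [partialDeriv, h2, fderiv_fun_sub h1 (hf.differentiable (by simp) x), fderiv_comp_add_right]
  simp [partialDeriv, increment]

theorem contDiff_increment {f : Plane → ℝ} (hf : ContDiff ℝ ∞ f) (v : Plane) :
    ContDiff ℝ ∞ (increment v f) :=
  (hf.comp (contDiff_id.add contDiff_const)).sub hf

theorem IsTestFunction.increment_neg {U V : Set Plane} {z : Plane → ℝ} {v : Plane}
    (hz : IsTestFunction U z) (hUV : U ⊆ V) (hv : ∀ x ∈ tsupport z, x + v ∈ V) :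
    IsTestFunction V (increment (-v) z) := by
  have hK : IsCompact ((fun x => x + v) '' tsupport z) :=
    IsCompact.image hz.2.1 (continuous_id.add continuous_const)
  have hK2 : IsCompact ((fun x => x + v) '' tsupport z ∪ tsupport z) := hK.union hz.2.1
  have hsub : tsupport (increment (-v) z) ⊆ (fun x => x + v) '' tsupport z ∪ tsupport z := by
    refine closure_minimal (fun x hx => ?_) hK2.isClosed
    by_contra hcon
    rw [mem_union, not_or] at hcon
    refine hx ?_
    have h1 : z (x + -v) = 0 := image_eq_zero_of_notMem_tsupport fun h => hcon.1 ⟨_, h, by simp⟩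
    simp [increment, h1, image_eq_zero_of_notMem_tsupport hcon.2]
  refine ⟨contDiff_increment hz.1 _, hK2.of_isClosed_subset (isClosed_tsupport _) hsub,
    hsub.trans (union_subset ?_ (hz.2.2.trans hUV))⟩
  rintro _ ⟨x, hx, rfl⟩
  exact hv x hx

/-- Testing `div σ = 0` with `Δ₋ᵥ(η² Δᵥ w)` for a smooth `w`, where `v = h eₖ`. Both increments
falling on `w` in the right-hand side are controlled by `|h|` times a derivative, so only the `L²`
norm of `σ` itself enters, and not that of its increments. -/
theorem sum_integral_increment_mul_le_of_smooth {U : Set Plane} {σ : Fin 2 → Plane → ℝ}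
    (hσ : ∀ j, MemLp (σ j) 2 volume)
    (hdiv : ∀ φ, IsTestFunction U φ → ∑ j, ∫ x, σ j x * partialDeriv j φ x = 0)
    {η w : Plane → ℝ} (hη : IsTestFunction U η) {C : ℝ} (hC1 : ∀ j x, |partialDeriv j η x| ≤ C)
    (hC2 : ∀ k j x, |partialDeriv k (partialDeriv j (fun x => η x * η x)) x| ≤ C)
    (hw : IsTestFunction univ w) (k : Fin 2) (h : ℝ)
    (hv : ∀ x ∈ tsupport η, x + h • EuclideanSpace.single k 1 ∈ U) :
    ∑ j, ∫ x, increment (h • EuclideanSpace.single k 1) (σ j) x *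
        (η x * η x * increment (h • EuclideanSpace.single k 1) (partialDeriv j w) x) ≤
      (∑ j, l2norm (σ j)) * (|h| * (C * (|h| * l2norm (partialDeriv k w)) + 2 * C * l2norm
        (fun x => η x * increment (h • EuclideanSpace.single k 1) (partialDeriv k w) x))) := by
  set v : Plane := h • EuclideanSpace.single k 1 with hvdef
  have hηη : IsTestFunction U (fun x => η x * η x) := hη.mul hη.1
  have hdw : ContDiff ℝ ∞ (increment v w) := contDiff_increment hw.1 v
  have hC0 : 0 ≤ C := (abs_nonneg _).trans (hC1 0 0)
  let z : Fin 2 → Plane → ℝ := fun j x => partialDeriv j (fun x => η x * η x) x * increment v w x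
  have hz : ∀ j, IsTestFunction U (z j) := fun j => (hηη.partialDeriv j).mul hdw
  let y : Fin 2 → Plane → ℝ := fun j x => η x * η x * increment v (partialDeriv j w) x
  have hy : ∀ j, IsTestFunction U (y j) := fun j =>
    hηη.mul (contDiff_increment (contDiff_partialDeriv hw.1 j) v)
  have hφ : IsTestFunction U (increment (-v) fun x => η x * η x * increment v w x) :=
    (hηη.mul hdw).increment_neg subset_rfl fun x hx =>
      hv x (tsupport_mul_subset_left (tsupport_mul_subset_left hx))
  have hφd : ∀ j x, partialDeriv j (increment (-v) fun x => η x * η x * increment v w x) x =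
      increment (-v) (z j) x + increment (-v) (y j) x := fun j x => by
    have e : ∀ x, partialDeriv j (fun x => η x * η x * increment v w x) x =
        partialDeriv j (fun x => η x * η x) x * increment v w x +
          η x * η x * increment v (partialDeriv j w) x := fun x => by
      rw [partialDeriv_mul hηη.1 hdw, partialDeriv_increment hw.1]
    rw [partialDeriv_increment (hηη.mul hdw).1, increment, e, e]
    simp only [increment, z, y]
    ring
  have hmz : ∀ j, MemLp (increment (-v) (z j)) 2 volume := fun j => memLp_increment (hz j).memLp _
  have hmy : ∀ j, MemLp (increment (-v) (y j)) 2 volume := fun j => memLp_increment (hy j).memLp _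
  have key := hdiv _ hφ
  have hterm : ∀ j, ∫ x, σ j x * partialDeriv j
      (increment (-v) fun x => η x * η x * increment v w x) x =
      (∫ x, σ j x * increment (-v) (z j) x) + ∫ x, increment v (σ j) x * y j x := fun j => by
    have i1 : Integrable fun x => σ j x * increment (-v) (z j) x := (hσ j).integrable_mul (hmz j)
    have i2 : Integrable fun x => σ j x * increment (-v) (y j) x := (hσ j).integrable_mul (hmy j)
    rw [integral_increment_mul (hσ j) (hy j).memLp, ← integral_add i1 i2]
    congr 1; ext x; rw [hφd]; ring
  simp_rw [hterm] at key
  rw [Finset.sum_add_distrib] at key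
  have hbound : ∀ j, l2norm (increment (-v) (z j)) ≤
      |h| * (C * (|h| * l2norm (partialDeriv k w)) + 2 * C * l2norm
        (fun x => η x * increment v (partialDeriv k w) x)) := fun j => by
    have hneg : -v = (-h) • EuclideanSpace.single k 1 := by rw [hvdef, neg_smul]
    rw [hneg]
    refine (l2norm_increment_le (hz j).1 (hz j).2.1 k (-h)).trans ?_
    rw [abs_neg]
    refine mul_le_mul_of_nonneg_left ?_ (abs_nonneg h)
    have hwm : MemLp (increment v w) 2 volume := memLp_increment hw.memLp v
    have hηd : MemLp (fun x => η x * increment v (partialDeriv k w) x) 2 volume :=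
      (hη.mul (contDiff_increment (contDiff_partialDeriv hw.1 k) v)).memLp
    have hsplit : partialDeriv k (z j) =
        (fun x => partialDeriv k (partialDeriv j (fun x => η x * η x)) x * increment v w x) +
        (fun x => (2 * partialDeriv j η x) * (η x * increment v (partialDeriv k w) x)) := by
      ext x
      have e1 : ∀ x, partialDeriv j (fun x => η x * η x) x = _ := partialDeriv_mul hη.1 hη.1 j
      rw [Pi.add_apply, partialDeriv_mul (hηη.partialDeriv j).1 hdw, partialDeriv_increment hw.1,
        e1]
      ring
    have hc1 : Continuous (partialDeriv k (partialDeriv j (fun x => η x * η x))) :=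
      ((hηη.partialDeriv j).partialDeriv k).1.continuous
    have hc3 : ∀ x, |2 * partialDeriv j η x| ≤ 2 * C := fun x => by
      rw [abs_mul, abs_two]; exact mul_le_mul_of_nonneg_left (hC1 j x) (by norm_num)
    rw [hsplit]
    refine (lpNorm_add_le (memLp_continuous_mul hwm hc1 (hC2 k j)) (by norm_num)).trans ?_
    refine add_le_add ((l2norm_bounded_mul_le hwm (hC2 k j)).trans ?_)
      (l2norm_bounded_mul_le hηd hc3)
    exact mul_le_mul_of_nonneg_left (l2norm_increment_le hw.1 hw.2.1 k h) hC0
  have hfin : ∀ j, -∫ x, σ j x * increment (-v) (z j) x ≤ l2norm (σ j) *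
      (|h| * (C * (|h| * l2norm (partialDeriv k w)) + 2 * C * l2norm
        (fun x => η x * increment v (partialDeriv k w) x))) := fun j =>
    (neg_le_abs _).trans ((abs_integral_mul_le (hσ j) (hmz j)).trans
      (mul_le_mul_of_nonneg_left (hbound j) lpNorm_nonneg))
  calc ∑ j, ∫ x, increment v (σ j) x * y j x
      = ∑ j, -∫ x, σ j x * increment (-v) (z j) x := by
        rw [Finset.sum_neg_distrib]; linarith
    _ ≤ _ := by
        rw [Finset.sum_mul]; exact Finset.sum_le_sum fun j _ => hfin j

/-- The estimate of `sum_integral_increment_mul_le_of_smooth` with the gradient of `w` replaced by a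
limit `p` of gradients of test functions. -/
theorem sum_integral_increment_mul_le {U : Set Plane} {σ p : Fin 2 → Plane → ℝ}
    (hσ : ∀ j, MemLp (σ j) 2 volume)
    (hdiv : ∀ φ, IsTestFunction U φ → ∑ j, ∫ x, σ j x * partialDeriv j φ x = 0)
    {η : Plane → ℝ} (hη : IsTestFunction U η) {C : ℝ} (hC1 : ∀ j x, |partialDeriv j η x| ≤ C)
    (hC2 : ∀ k j x, |partialDeriv k (partialDeriv j (fun x => η x * η x)) x| ≤ C)
    (hp : ∀ j, MemLp (p j) 2 volume) {W : ℕ → Plane → ℝ}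
    (hW : ∀ n, ContDiff ℝ ∞ (W n) ∧ HasCompactSupport (W n))
    (hWp : ∀ j, TendstoL2 (fun n => partialDeriv j (W n)) (p j)) (k : Fin 2) (h : ℝ)
    (hv : ∀ x ∈ tsupport η, x + h • EuclideanSpace.single k 1 ∈ U) :
    ∑ j, ∫ x, increment (h • EuclideanSpace.single k 1) (σ j) x *
        (η x * η x * increment (h • EuclideanSpace.single k 1) (p j) x) ≤
      (∑ j, l2norm (σ j)) * (|h| * (C * (|h| * l2norm (p k)) + 2 * C * l2norm
        (fun x => η x * increment (h • EuclideanSpace.single k 1) (p k) x))) := by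
  set v : Plane := h • EuclideanSpace.single k 1 with hvdef
  have hWt : ∀ n, IsTestFunction univ (W n) := fun n => ⟨(hW n).1, (hW n).2, subset_univ _⟩
  have hWm : ∀ j n, MemLp (partialDeriv j (W n)) 2 volume := fun j n =>
    ((hWt n).partialDeriv j).memLp
  obtain ⟨C0, hC0⟩ := hη.exists_bound
  obtain ⟨C3, hC3⟩ := (hη.mul hη.1).exists_bound
  refine le_of_tendsto_of_tendsto' (b := (atTop : Filter ℕ)) ?_ ?_ fun n =>
    sum_integral_increment_mul_le_of_smooth hσ hdiv hη hC1 hC2 (hWt n) k h hv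
  · refine tendsto_finsetSum _ fun j _ => ?_
    refine TendstoL2.tendsto_integral_mul (((hWp j).increment (hWm j) (hp j) v).bounded_mul
      (fun n => memLp_increment (hWm j n) v) (memLp_increment (hp j) v) hC3) (fun n => memLp_continuous_mul
        (memLp_increment (hWm j n) v) (hη.mul hη.1).1.continuous hC3)
      (memLp_continuous_mul (memLp_increment (hp j) v) (hη.mul hη.1).1.continuous hC3)
      (memLp_increment (hσ j) v)
  · have t1 := (hWp k).tendsto_l2norm (hWm k) (hp k)
    have t2 := (((hWp k).increment (hWm k) (hp k) v).bounded_mul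
      (fun n => memLp_increment (hWm k n) v) (memLp_increment (hp k) v) hC0).tendsto_l2norm (fun n => memLp_continuous_mul (memLp_increment (hWm k n) v)
          hη.1.continuous hC0) (memLp_continuous_mul (memLp_increment (hp k) v)
          hη.1.continuous hC0)
    exact (((((t1.const_mul |h|).const_mul C).add (t2.const_mul (2 * C))).const_mul |h|).const_mul _)

/-- Nirenberg's estimate for a strongly monotone system: if the `L²` field `S` has divergence zero
in `U` and is strongly monotone in the gradient `H`, then the difference quotients of `H` are
bounded in `L²` on compact subsets of `U`. -/
theorem exists_l2norm_increment_le {U : Set Plane} (hU : IsOpen U)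
    {S H : Fin 2 → Fin 2 → Plane → ℝ} {lam : ℝ} (hlam : 0 < lam)
    (hS : ∀ i j, MemLp (S i j) 2 volume) (hH : ∀ i j, MemLp (H i j) 2 volume)
    (hmono : ∀ x y, lam * ∑ i, ∑ j, (H i j y - H i j x) ^ 2 ≤
      ∑ i, ∑ j, (S i j y - S i j x) * (H i j y - H i j x))
    (hdiv : ∀ i φ, IsTestFunction U φ → ∑ j, ∫ x, S i j x * partialDeriv j φ x = 0)
    (happrox : ∀ i, ∃ W : ℕ → Plane → ℝ, (∀ n, ContDiff ℝ ∞ (W n) ∧ HasCompactSupport (W n)) ∧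
      ∀ j, TendstoL2 (fun n => partialDeriv j (W n)) (H i j))
    {η : Plane → ℝ} (hη : IsTestFunction U η) :
    ∃ M δ : ℝ, 0 < δ ∧ ∀ i j k h, |h| < δ →
      l2norm (fun x => η x * increment (h • EuclideanSpace.single k 1) (H i j) x) ≤ M * |h| := by
  have hηη : IsTestFunction U (fun x => η x * η x) := hη.mul hη.1
  choose W hW hWH using happrox
  choose C1 hC1 using fun j => (hη.partialDeriv j).exists_bound
  choose C2 hC2 using fun k j => ((hηη.partialDeriv j).partialDeriv k).exists_bound
  obtain ⟨C0, hC0⟩ := hη.exists_bound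
  obtain ⟨C, hCpos, hC1', hC2'⟩ : ∃ C : ℝ, 0 ≤ C ∧ (∀ j x, |partialDeriv j η x| ≤ C) ∧
      ∀ k j x, |partialDeriv k (partialDeriv j (fun x => η x * η x)) x| ≤ C := by
    have n1 : ∀ j, 0 ≤ C1 j := fun j => (abs_nonneg _).trans (hC1 j 0)
    have n2 : ∀ k j, 0 ≤ C2 k j := fun k j => (abs_nonneg _).trans (hC2 k j 0)
    have n3 : 0 ≤ ∑ j, C1 j := Finset.sum_nonneg fun j _ => n1 j
    have n4 : 0 ≤ ∑ k, ∑ j, C2 k j := Finset.sum_nonneg fun k _ => Finset.sum_nonneg fun j _ => n2 k j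
    refine ⟨∑ j, C1 j + ∑ k, ∑ j, C2 k j, by positivity, fun j x => ?_, fun k j x => ?_⟩
    · have := Finset.single_le_sum (fun j _ => n1 j) (Finset.mem_univ j)
      linarith [hC1 j x]
    · have a1 := Finset.single_le_sum (fun j _ => n2 k j) (Finset.mem_univ j)
      have a2 := Finset.single_le_sum (s := Finset.univ) (f := fun k => ∑ j, C2 k j) (fun k _ => Finset.sum_nonneg fun j _ => n2 k j)
        (Finset.mem_univ k)
      linarith [hC2 k j x]
  obtain ⟨δ, hδ, hδU⟩ := (show IsCompact (tsupport η) from hη.2.1).exists_thickening_subset_open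
    hU hη.2.2
  set P : ℝ := ∑ i, ∑ j, l2norm (H i j) with hP
  set Q : ℝ := ∑ i, ∑ j, l2norm (S i j) with hQ
  have hP0 : 0 ≤ P := Finset.sum_nonneg fun i _ => Finset.sum_nonneg fun j _ => lpNorm_nonneg
  have hQ0 : 0 ≤ Q := Finset.sum_nonneg fun i _ => Finset.sum_nonneg fun j _ => lpNorm_nonneg
  have hPle : ∀ i j, l2norm (H i j) ≤ P := fun i j =>
    (Finset.single_le_sum (f := fun j => l2norm (H i j)) (fun j _ => lpNorm_nonneg)
      (Finset.mem_univ j)).trans (Finset.single_le_sum (f := fun i => ∑ j, l2norm (H i j))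
        (fun i _ => Finset.sum_nonneg fun j _ => lpNorm_nonneg) (Finset.mem_univ i))
  set B : ℝ := Q * (C * P + 2 * C) with hB
  have hB0 : 0 ≤ B := by positivity
  refine ⟨B / lam + 1, δ, hδ, fun i j k h hh => ?_⟩
  set v : Plane := h • EuclideanSpace.single k 1 with hvdef
  have hv : ∀ x ∈ tsupport η, x + v ∈ U := fun x hx => hδU <| by
    rw [Metric.mem_thickening_iff]
    exact ⟨x, hx, by simpa [hvdef, norm_smul] using hh⟩
  set T : Fin 2 → Fin 2 → ℝ := fun i j => l2norm (fun x => η x * increment v (H i j) x) with hT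
  have hTm : ∀ i j, MemLp (fun x => η x * increment v (H i j) x) 2 volume := fun i j =>
    memLp_continuous_mul (memLp_increment (hH i j) v) hη.1.continuous hC0
  have hT0 : ∀ i j, 0 ≤ T i j := fun i j => lpNorm_nonneg
  set X : ℝ := √(∑ i, ∑ j, T i j ^ 2) with hX
  have hXsq : X ^ 2 = ∑ i, ∑ j, T i j ^ 2 :=
    Real.sq_sqrt (Finset.sum_nonneg fun i _ => Finset.sum_nonneg fun j _ => sq_nonneg _)
  have hX0 : 0 ≤ X := Real.sqrt_nonneg _
  have hTX : ∀ i j, T i j ≤ X := fun i j => by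
    refine Real.le_sqrt_of_sq_le ?_
    exact (Finset.single_le_sum (f := fun j => T i j ^ 2) (fun j _ => sq_nonneg _)
      (Finset.mem_univ j)).trans (Finset.single_le_sum (f := fun i => ∑ j, T i j ^ 2)
        (fun i _ => Finset.sum_nonneg fun j _ => sq_nonneg _) (Finset.mem_univ i))
  -- strong monotonicity, integrated against `η²`
  have hlow : lam * X ^ 2 ≤ ∑ i, ∑ j, ∫ x, increment v (S i j) x *
      (η x * η x * increment v (H i j) x) := by
    have hi1 : ∀ i j, Integrable fun x => (η x * increment v (H i j) x) ^ 2 := fun i j =>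
      (hTm i j).integrable_sq
    have hi2 : ∀ i j, Integrable fun x => increment v (S i j) x *
        (η x * η x * increment v (H i j) x) := fun i j => by
      have := (memLp_continuous_mul (memLp_increment (hS i j) v) hη.1.continuous
        hC0).integrable_mul (hTm i j)
      refine this.congr (ae_of_all _ fun x => ?_)
      simp only [Pi.mul_apply]; ring
    simp_rw [hXsq, hT, l2norm_sq (hTm _ _)]
    simp_rw [← integral_finsetSum _ fun j (_ : j ∈ Finset.univ) => hi1 _ j,
      ← integral_finsetSum _ fun j (_ : j ∈ Finset.univ) => hi2 _ j]
    rw [← integral_finsetSum _ fun i _ => integrable_finsetSum _ fun j _ => hi1 i j,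
      ← integral_finsetSum _ fun i _ => integrable_finsetSum _ fun j _ => hi2 i j,
      ← integral_const_mul]
    refine integral_mono ((integrable_finsetSum _ fun i _ => integrable_finsetSum _ fun j _ =>
      hi1 i j).const_mul lam) (integrable_finsetSum _ fun i _ => integrable_finsetSum _ fun j _ =>
      hi2 i j) fun x => ?_
    have := mul_le_mul_of_nonneg_left (hmono x (x + v)) (mul_self_nonneg (η x))
    simp only [Fin.sum_univ_two, increment] at this ⊢
    linarith
  have hup : ∑ i, ∑ j, ∫ x, increment v (S i j) x * (η x * η x * increment v (H i j) x) ≤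
      B * |h| * (X + |h|) := by
    have hrow : ∀ i, ∑ j, ∫ x, increment v (S i j) x * (η x * η x * increment v (H i j) x) ≤
        (∑ j, l2norm (S i j)) * (|h| * ((C * P + 2 * C) * (X + |h|))) := fun i => by
      refine (sum_integral_increment_mul_le (hS i) (hdiv i) hη hC1' hC2' (hH i) (hW i) (hWH i) k h
        hv).trans ?_
      have q0 : 0 ≤ ∑ j, l2norm (S i j) := Finset.sum_nonneg fun j _ => lpNorm_nonneg
      have h1 : C * (|h| * l2norm (H i k)) ≤ C * (|h| * P) := by
        gcongr; exact hPle i k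
      have h2 : 2 * C * T i k ≤ 2 * C * X := by
        gcongr; exact hTX i k
      have h3 : C * (|h| * l2norm (H i k)) + 2 * C * T i k ≤ (C * P + 2 * C) * (X + |h|) := by
        have : 0 ≤ C * P * X := by positivity
        have : 0 ≤ 2 * C * |h| := by positivity
        linarith
      exact mul_le_mul_of_nonneg_left (mul_le_mul_of_nonneg_left h3 (abs_nonneg h)) q0
    refine (Finset.sum_le_sum fun i _ => hrow i).trans (le_of_eq ?_)
    rw [← Finset.sum_mul, hB]; ring
  have hmain : lam * X ^ 2 ≤ B * |h| * (X + |h|) := hlow.trans hup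
  refine (hTX i j).trans ?_
  -- absorption: if `X > (B / lam + 1) |h|`, then `lam X² > B |h| (X + |h|)`
  by_contra! hcon
  have ha : 0 ≤ |h| := abs_nonneg h
  have e1 : (B + lam) * |h| < lam * X := by
    have := mul_lt_mul_of_pos_left hcon hlam
    calc (B + lam) * |h| = lam * ((B / lam + 1) * |h|) := by field_simp
      _ < lam * X := this
  have hXpos : 0 < X := lt_of_le_of_lt (by positivity) hcon
  have e2 : (B + lam) * |h| * X < lam * X * X := mul_lt_mul_of_pos_right e1 hXpos
  have e3 : (B + lam) * |h| * |h| ≤ lam * X * |h| := mul_le_mul_of_nonneg_right e1.le ha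
  have e4 : 0 ≤ lam * |h| * |h| := by positivity
  linarith

/-! ### The stress tensor -/

/-- The stress `A + ρ'(det A) cof A`, the gradient of the energy density `½|A|² + ρ(det A)`. -/
noncomputable def stress (ρ : ℝ → ℝ) (A : Matrix (Fin 2) (Fin 2) ℝ) : Matrix (Fin 2) (Fin 2) ℝ :=
  A + deriv ρ A.det • cof A

namespace IsVolumetricDensity

variable {γ s₀ κ : ℝ} {ρ : ℝ → ℝ}

theorem continuous_deriv (h : IsVolumetricDensity γ s₀ κ ρ) : Continuous (deriv ρ) :=
  h.smooth.continuous_deriv (by simp)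

theorem deriv_eq_zero (h : IsVolumetricDensity γ s₀ κ ρ) {s : ℝ} (hs : s ≤ 0) :
    deriv ρ s = 0 := by
  have h1 : EqOn (deriv ρ) (fun _ => 0) (Iio 0) := fun t ht => by
    have : ρ =ᶠ[𝓝 t] fun _ => 0 := by
      filter_upwards [Iio_mem_nhds ht] with x hx using h.eq_zero x (le_of_lt hx)
    rw [this.deriv_eq, deriv_const]
  have h2 := h1.closure h.continuous_deriv continuous_const
  rw [closure_Iio] at h2
  exact h2 hs

theorem deriv_eq_of_le (h : IsVolumetricDensity γ s₀ κ ρ) {s : ℝ} (hs : s₀ ≤ s) :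
    deriv ρ s = γ := by
  have h1 : EqOn (deriv ρ) (fun _ => γ) (Ioi s₀) := fun t ht => by
    have : ρ =ᶠ[𝓝 t] fun s => γ * s + κ := by
      filter_upwards [Ioi_mem_nhds ht] with x hx using h.eq_affine x (le_of_lt hx)
    rw [this.deriv_eq]
    simp
  have h2 := h1.closure h.continuous_deriv continuous_const
  rw [closure_Ioi] at h2
  exact h2 hs

theorem monotone_deriv (h : IsVolumetricDensity γ s₀ κ ρ) : Monotone (deriv ρ) := by
  have hmono := h.convex.monotoneOn_deriv fun x _ => h.smooth.differentiable (by simp) x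
  -- `ρ'` is constant outside `[0, s₀]`, so it factors through the projection onto that interval
  have hclamp : ∀ x, deriv ρ x = deriv ρ (max 0 (min x s₀)) := fun x => by
    rcases le_total x 0 with hx | hx
    · rw [max_eq_left ((min_le_left x s₀).trans hx), h.deriv_eq_zero hx, h.deriv_eq_zero le_rfl]
    rcases le_total s₀ x with hs | hs
    · rw [min_eq_right hs, max_eq_right h.s₀_nonneg, h.deriv_eq_of_le hs,
        h.deriv_eq_of_le le_rfl]
    · rw [min_eq_left hs, max_eq_right hx]
  have hmem : ∀ x, max 0 (min x s₀) ∈ Icc 0 s₀ := fun x =>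
    ⟨le_max_left _ _, max_le h.s₀_nonneg (min_le_right _ _)⟩
  intro x y hxy
  rw [hclamp x, hclamp y]
  exact hmono (hmem x) (hmem y) (max_le_max_left _ (min_le_min_right _ hxy))

theorem deriv_nonneg (h : IsVolumetricDensity γ s₀ κ ρ) (s : ℝ) : 0 ≤ deriv ρ s := by
  rw [← h.deriv_eq_zero (min_le_right s 0)]
  exact h.monotone_deriv (min_le_left s 0)

theorem deriv_le (h : IsVolumetricDensity γ s₀ κ ρ) (s : ℝ) : deriv ρ s ≤ γ := by
  rw [← h.deriv_eq_of_le (le_max_right s s₀)]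
  exact h.monotone_deriv (le_max_left s s₀)

/-- The stress is strongly monotone. With `p = ρ'(det B)`, `q = ρ'(det A)` and `D = B - A`,
`(p cof B - q cof A) · D = (p + q) det D + (p - q) (det B - det A)`, where the last term is
nonnegative as `ρ'` is monotone, and `2 |det D| ≤ |D|²`. -/
theorem stress_monotone (h : IsVolumetricDensity γ s₀ κ ρ) (A B : Matrix (Fin 2) (Fin 2) ℝ) :
    (1 - γ) * ∑ i, ∑ j, (B i j - A i j) ^ 2 ≤
      ∑ i, ∑ j, (stress ρ B i j - stress ρ A i j) * (B i j - A i j) := by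
  have hp0 := h.deriv_nonneg B.det
  have hq0 := h.deriv_nonneg A.det
  have hpq : 0 ≤ (deriv ρ B.det - deriv ρ A.det) * (B.det - A.det) := by
    rcases le_total A.det B.det with hd | hd
    · exact mul_nonneg (sub_nonneg.2 (h.monotone_deriv hd)) (sub_nonneg.2 hd)
    · exact mul_nonneg_of_nonpos_of_nonpos (sub_nonpos.2 (h.monotone_deriv hd))
        (sub_nonpos.2 hd)
  have hp1 := h.deriv_le B.det
  have hq1 := h.deriv_le A.det
  simp only [stress, cof, Matrix.adjugate_fin_two, Fin.sum_univ_two, Matrix.add_apply,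
    Matrix.smul_apply, Matrix.transpose_apply, smul_eq_mul, Matrix.of_apply, Matrix.cons_val',
    Matrix.cons_val_zero, Matrix.cons_val_one, Matrix.cons_val_fin_one]
  generalize deriv ρ B.det = p at *
  generalize deriv ρ A.det = q at *
  rw [Matrix.det_fin_two, Matrix.det_fin_two] at hpq
  set a := B 0 0 - A 0 0 with ha
  set b := B 0 1 - A 0 1 with hb
  set c := B 1 0 - A 1 0 with hc
  set d := B 1 1 - A 1 1 with hd
  have h1 : 0 ≤ (p + q) * ((a + d) ^ 2 + (b - c) ^ 2) := by positivity
  have h2 : 0 ≤ (2 * γ - (p + q)) * (a ^ 2 + b ^ 2 + c ^ 2 + d ^ 2) :=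
    mul_nonneg (by linarith) (by positivity)
  have h3 : (B 0 0 + p * B 1 1 - (A 0 0 + q * A 1 1)) * a +
      (B 0 1 + p * -B 1 0 - (A 0 1 + q * -A 1 0)) * b +
      ((B 1 0 + p * -B 0 1 - (A 1 0 + q * -A 0 1)) * c +
      (B 1 1 + p * B 0 0 - (A 1 1 + q * A 0 0)) * d) =
      a ^ 2 + b ^ 2 + c ^ 2 + d ^ 2 + (p + q) * (a * d - b * c) +
      (p - q) * (B 0 0 * B 1 1 - B 0 1 * B 1 0 - (A 0 0 * A 1 1 - A 0 1 * A 1 0)) := by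
    rw [ha, hb, hc, hd]; ring
  linarith

theorem memLp_stress (h : IsVolumetricDensity γ s₀ κ ρ) {G : Plane → Matrix (Fin 2) (Fin 2) ℝ}
    (hG : ∀ i j, MemLp (fun x => G x i j) 2 volume) (i j : Fin 2) :
    MemLp (fun x => stress ρ (G x) i j) 2 volume := by
  have hdet : AEStronglyMeasurable (fun x => (G x).det) volume := by
    simp_rw [Matrix.det_fin_two]
    exact ((hG 0 0).1.mul (hG 1 1).1).sub ((hG 0 1).1.mul (hG 1 0).1)
  have hρ : AEStronglyMeasurable (fun x => deriv ρ (G x).det) volume :=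
    h.continuous_deriv.comp_aestronglyMeasurable hdet
  have hcof : ∀ i j, MemLp (fun x => cof (G x) i j) 2 volume := fun i j => by
    fin_cases i <;> fin_cases j <;> simp only [cof, Matrix.adjugate_fin_two, Matrix.transpose_apply]
    · exact hG 1 1
    · exact (hG 1 0).neg
    · exact (hG 0 1).neg
    · exact hG 0 0
  refine (hG i j).add ((hcof i j).of_le_mul (c := γ) (hρ.mul (hcof i j).1)
    (ae_of_all _ fun x => ?_))
  change ‖deriv ρ (G x).det * cof (G x) i j‖ ≤ _
  rw [norm_mul, Real.norm_of_nonneg (h.deriv_nonneg _)]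
  exact mul_le_mul_of_nonneg_right (h.deriv_le _) (norm_nonneg _)

end IsVolumetricDensity

/-! ### Localization -/

theorem exists_cutoff {K O : Set Plane} (hK : IsCompact K) (hO : IsOpen O) (hKO : K ⊆ O) :
    ∃ (η : Plane → ℝ) (U : Set Plane), IsTestFunction O η ∧ IsOpen U ∧ K ⊆ U ∧ U ⊆ O ∧
      ∀ x ∈ U, η x = 1 := by
  obtain ⟨L, hL, hKL, hLO⟩ := exists_compact_between hK hO hKO
  obtain ⟨f, hf1, hf0, -⟩ := exists_contMDiffMap_one_nhds_of_subset_interior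
    (n := (⊤ : ℕ∞)) (modelWithCornersSelf ℝ Plane) hK.isClosed hKL
  obtain ⟨U, hU, hKU, hUf⟩ := mem_nhdsSet_iff_exists.1 hf1
  have hsub : tsupport f ⊆ L := closure_minimal (fun x hx => by
    by_contra h; exact hx (hf0 x h)) hL.isClosed
  exact ⟨f, U ∩ O, ⟨f.contMDiff.contDiff, hL.of_isClosed_subset (isClosed_tsupport _) hsub,
    hsub.trans hLO⟩, hU.inter hO, subset_inter hKU hKO, inter_subset_right,
    fun x hx => hUf hx.1⟩

theorem partialDeriv_eq_zero_of_eq_one {U : Set Plane} {ζ : Plane → ℝ}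
    (hU : IsOpen U) (h : ∀ x ∈ U, ζ x = 1) (j : Fin 2) {x : Plane} (hx : x ∈ U) :
    partialDeriv j ζ x = 0 := by
  have : ζ =ᶠ[𝓝 x] fun _ => 1 := by filter_upwards [hU.mem_nhds hx] with y hy using h y hy
  rw [partialDeriv, this.fderiv_eq]
  simp

theorem IsTestFunction.setIntegral_mul {Ω : Set Plane} {φ : Plane → ℝ} (h : IsTestFunction Ω φ)
    (f : Plane → ℝ) : ∫ x in Ω, f x * φ x = ∫ x, f x * φ x :=
  setIntegral_eq_integral_of_forall_compl_eq_zero fun x hx => by rw [h.eq_zero hx, mul_zero]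

theorem IsTestFunction.memLp_mul {Ω : Set Plane} (hΩ : MeasurableSet Ω) {ζ f : Plane → ℝ}
    (hζ : IsTestFunction Ω ζ) (hf : MemLp f 2 (volume.restrict Ω)) :
    MemLp (fun x => ζ x * f x) 2 volume := by
  obtain ⟨C, hC⟩ := hζ.exists_bound
  have := memLp_continuous_mul ((memLp_indicator_iff_restrict hΩ).2 hf) hζ.1.continuous hC
  convert this using 2 with x
  by_cases hx : x ∈ Ω
  · simp [hx]
  · simp [hx, hζ.eq_zero hx]

/-- The Leibniz rule for the product of a Sobolev function with a cutoff, extended by zero. -/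
theorem HasWeakPartial.cutoff_mul {Ω : Set Plane} (hΩ : MeasurableSet Ω) {f g ζ : Plane → ℝ}
    {j : Fin 2} (h : HasWeakPartial Ω j f g) (hf : MemLp f 2 (volume.restrict Ω))
    (hg : MemLp g 2 (volume.restrict Ω)) (hζ : IsTestFunction Ω ζ) :
    HasWeakPartial univ j (fun x => ζ x * f x) (fun x => ζ x * g x + partialDeriv j ζ x * f x) := by
  have m1 := hζ.memLp_mul hΩ hf
  have m2 := hζ.memLp_mul hΩ hg
  have m3 := (hζ.partialDeriv j).memLp_mul hΩ hf
  refine ⟨(m1.locallyIntegrable (by norm_num)).locallyIntegrableOn _,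
    ((m2.add m3).locallyIntegrable (by norm_num)).locallyIntegrableOn _, fun φ hφ => ?_⟩
  have ht : IsTestFunction Ω (fun x => ζ x * φ x) := hζ.mul hφ.1
  have key := h.2.2 _ ht
  have e1 : ∀ x, fderiv ℝ (fun x => ζ x * φ x) x (EuclideanSpace.single j 1) =
      partialDeriv j ζ x * φ x + ζ x * partialDeriv j φ x := fun x =>
    partialDeriv_mul hζ.1 hφ.1 j x
  have e2 := (ht.partialDeriv j).setIntegral_mul f
  simp only [partialDeriv] at e2
  rw [e2, ht.setIntegral_mul g] at key
  simp_rw [e1] at key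
  have i1 : Integrable fun x => partialDeriv j ζ x * f x * φ x := m3.integrable_mul hφ.memLp
  have i2 : Integrable fun x => ζ x * f x * partialDeriv j φ x :=
    m1.integrable_mul (hφ.partialDeriv j).memLp
  have i3 : Integrable fun x => ζ x * g x * φ x := m2.integrable_mul hφ.memLp
  have k1 : ∫ x, f x * (partialDeriv j ζ x * φ x + ζ x * partialDeriv j φ x) =
      (∫ x, partialDeriv j ζ x * f x * φ x) + ∫ x, ζ x * f x * partialDeriv j φ x := by
    rw [← integral_add i1 i2]; congr 1; ext x; ring
  have k2 : ∫ x, (ζ x * g x + partialDeriv j ζ x * f x) * φ x =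
      (∫ x, ζ x * g x * φ x) + ∫ x, partialDeriv j ζ x * f x * φ x := by
    rw [← integral_add i3 i1]; congr 1; ext x; ring
  have k3 : ∫ x, g x * (ζ x * φ x) = ∫ x, ζ x * g x * φ x := by
    congr 1; ext x; ring
  rw [k1, k3] at key
  simp only [Measure.restrict_univ]
  rw [k2]
  simp only [partialDeriv] at key ⊢
  linarith

theorem HasWeakPartial.mono {Ω V : Set Plane} {j : Fin 2} {f g : Plane → ℝ}
    (h : HasWeakPartial Ω j f g) (hV : V ⊆ Ω) : HasWeakPartial V j f g := by
  refine ⟨h.1.mono_set hV, h.2.1.mono_set hV, fun φ hφ => ?_⟩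
  have e1 := (hφ.partialDeriv j).setIntegral_mul f
  have e2 := ((hφ.partialDeriv j).mono hV).setIntegral_mul f
  simp only [partialDeriv] at e1 e2
  rw [e1, ← e2, h.2.2 φ (hφ.mono hV), (hφ.mono hV).setIntegral_mul, hφ.setIntegral_mul]

theorem IsTestFunction.hasWeakPartial {Ω : Set Plane} {φ : Plane → ℝ} (hφ : IsTestFunction Ω φ)
    (j : Fin 2) : HasWeakPartial Ω j φ (Elasticity.partialDeriv j φ) := by
  refine ⟨(hφ.1.continuous.locallyIntegrable).locallyIntegrableOn _,
    ((hφ.partialDeriv j).1.continuous.locallyIntegrable).locallyIntegrableOn _, fun ψ hψ => ?_⟩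
  have e := (hψ.partialDeriv j).setIntegral_mul φ
  simp only [Elasticity.partialDeriv] at e
  rw [e, hψ.setIntegral_mul]
  exact integral_mul_fderiv_eq_neg_fderiv_mul_of_integrable
    ((hφ.partialDeriv j).memLp.integrable_mul hψ.memLp)
    (hφ.memLp.integrable_mul (hψ.partialDeriv j).memLp) (hφ.memLp.integrable_mul hψ.memLp)
    (fun x _ => hφ.1.differentiable (by simp) x) (fun x _ => hψ.1.differentiable (by simp) x)

theorem IsTestFunction.coord {Ω : Set Plane} {φ : Plane → Plane} (hφ : IsTestFunction Ω φ)
    (i : Fin 2) : IsTestFunction Ω (fun x => φ x i) := by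
  have hsub : tsupport (fun x => φ x i) ⊆ tsupport φ :=
    closure_mono fun x hx h => hx (by simp [h])
  exact ⟨(EuclideanSpace.proj (𝕜 := ℝ) i).contDiff.comp hφ.1,
    hφ.2.1.of_isClosed_subset (isClosed_tsupport _) hsub, hsub.trans hφ.2.2⟩

theorem partialDeriv_coord {φ : Plane → Plane} (hφ : ContDiff ℝ ∞ φ) (i j : Fin 2) :
    partialDeriv j (fun x => φ x i) = fun x => fderiv ℝ φ x (EuclideanSpace.single j 1) i := by
  ext x
  have h := (EuclideanSpace.proj (𝕜 := ℝ) i).hasFDerivAt.comp x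
    (hφ.differentiable (by simp) x).hasFDerivAt
  have h2 : fderiv ℝ (fun x => φ x i) x = _ := h.fderiv
  rw [partialDeriv, h2]
  rfl

theorem IsTestFunction.hasSobolevGradient {Ω : Set Plane} {φ : Plane → Plane}
    (hφ : IsTestFunction Ω φ) : HasSobolevGradient Ω φ
      (fun x => Matrix.of fun i j => fderiv ℝ φ x (EuclideanSpace.single j 1) i) := fun i => by
  refine ⟨(hφ.coord i).memLp.restrict Ω, fun j => ?_⟩
  have e := partialDeriv_coord hφ.1 i j
  simp only [Matrix.of_apply]
  rw [← e]
  exact ⟨((hφ.coord i).partialDeriv j).memLp.restrict Ω, (hφ.coord i).hasWeakPartial j⟩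

theorem IsTestFunction.memSobolevZero {Ω : Set Plane} {φ : Plane → Plane}
    (hφ : IsTestFunction Ω φ) : MemSobolevZero Ω φ :=
  ⟨_, hφ.hasSobolevGradient, fun _ => φ, fun _ => hφ, fun i => by simp, fun i j => by simp⟩

/-! ### Regularity of stationary points -/

/-- The rows of the stress of a stationary point are weakly divergence free: the Euler-Lagrange
equation tested with a smooth field having a single nonzero component. -/
theorem sum_integral_stress_mul_eq_zero {Ω U : Set Plane} {ρ : ℝ → ℝ}
    {G H : Plane → Matrix (Fin 2) (Fin 2) ℝ}
    (hEL : ∀ (φ : Plane → Plane) (Φ : Plane → Matrix (Fin 2) (Fin 2) ℝ),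
      MemSobolevZero Ω φ → HasSobolevGradient Ω φ Φ →
        ∫ x in Ω, frobeniusInner (G x + deriv ρ (G x).det • cof (G x)) (Φ x) = 0)
    (hUΩ : U ⊆ Ω) (hHG : ∀ x ∈ U, H x = G x)
    (hS : ∀ i j, MemLp (fun x => stress ρ (H x) i j) 2 volume) (i : Fin 2) {φ : Plane → ℝ}
    (hφ : IsTestFunction U φ) : ∑ j, ∫ x, stress ρ (H x) i j * partialDeriv j φ x = 0 := by
  let ψ : Plane → Plane := fun x => φ x • EuclideanSpace.single i 1
  have hψ : IsTestFunction Ω ψ := by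
    have hsub : tsupport ψ ⊆ tsupport φ := closure_mono fun x hx h => hx (by simp [ψ, h])
    exact ⟨hφ.1.smul contDiff_const, hφ.2.1.of_isClosed_subset (isClosed_tsupport _) hsub,
      (hsub.trans hφ.2.2).trans hUΩ⟩
  have h := hEL ψ _ hψ.memSobolevZero hψ.hasSobolevGradient
  have hfd : ∀ x l j, fderiv ℝ ψ x (EuclideanSpace.single j 1) l =
      partialDeriv j φ x * (EuclideanSpace.single i (1 : ℝ) : Plane) l := fun x l j => by
    have h1 : HasFDerivAt ψ _ x :=
      (hφ.1.differentiable (by simp) x).hasFDerivAt.smul_const (EuclideanSpace.single i (1 : ℝ))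
    rw [h1.fderiv]
    rfl
  have hint : ∀ x, frobeniusInner (G x + deriv ρ (G x).det • cof (G x))
      (Matrix.of fun l j => fderiv ℝ ψ x (EuclideanSpace.single j 1) l) =
        ∑ j, stress ρ (H x) i j * partialDeriv j φ x := fun x => by
    by_cases hx : x ∈ U
    · rw [hHG x hx]
      simp only [frobeniusInner, Matrix.of_apply, hfd, stress]
      fin_cases i <;> simp
    · have h0 : ∀ j, partialDeriv j φ x = 0 := fun j => (hφ.partialDeriv j).eq_zero hx
      simp [frobeniusInner, hfd, h0]
  simp_rw [hint] at h
  have hi : ∀ j ∈ Finset.univ, Integrable fun x => stress ρ (H x) i j * partialDeriv j φ x :=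
    fun j _ => (hS i j).integrable_mul (hφ.partialDeriv j).memLp
  rwa [setIntegral_eq_integral_of_forall_compl_eq_zero fun x hx => Finset.sum_eq_zero fun j _ => by
      rw [((hφ.partialDeriv j).mono hUΩ).eq_zero hx, mul_zero],
    integral_finsetSum _ hi] at h

end Elasticity

theorem theorem1p3 (Ω : Set Elasticity.Plane) (hΩ : IsOpen Ω) (hΩb : Bornology.IsBounded Ω)
    (γ s₀ κ : ℝ) (hγ0 : 0 < γ) (hγ1 : γ < 1)
    (ρ : ℝ → ℝ) (hρ : Elasticity.IsVolumetricDensity γ s₀ κ ρ)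
    (u₀ : Elasticity.Plane → Elasticity.Plane) (hu₀ : Elasticity.MemSobolev 1 Ω u₀)
    (u : Elasticity.Plane → Elasticity.Plane)
    (hu : Elasticity.IsStationaryPoint Ω ρ u₀ u) :
    Elasticity.MemSobolevLoc 2 Ω u := by
  open Elasticity in
  obtain ⟨-, G, hG, hEL⟩ := hu
  intro V hV hVc hVΩ
  obtain ⟨η, O, hη, -, hKO, -, hηO⟩ := exists_cutoff hVc hΩ hVΩ
  obtain ⟨ζ, U, hζ, hU, hηU, hUΩ, hζU⟩ := exists_cutoff hη.2.1 hΩ hη.2.2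
  have hηV : ∀ x ∈ V, η x = 1 := fun x hx => hηO x (hKO (subset_closure hx))
  have hVU : V ⊆ U := fun x hx => hηU (subset_tsupport η (by simp [hηV x hx]))
  -- the gradient of the compactly supported function `ζ u`, which is `∇u` on `U`
  let H : Plane → Matrix (Fin 2) (Fin 2) ℝ := fun x =>
    Matrix.of fun i j => ζ x * G x i j + partialDeriv j ζ x * u x i
  have hHG : ∀ x ∈ U, H x = G x := fun x hx => by
    ext i j
    simp [H, hζU x hx, partialDeriv_eq_zero_of_eq_one hU hζU j hx]
  have hH : ∀ i j, MemLp (fun x => H x i j) 2 volume := fun i j =>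
    (hζ.memLp_mul hΩ.measurableSet ((hG i).2 j).1).add
      ((hζ.partialDeriv j).memLp_mul hΩ.measurableSet (hG i).1)
  have hw : ∀ i j, HasWeakPartial univ j (fun x => ζ x * u x i) (fun x => H x i j) := fun i j =>
    ((hG i).2 j).2.cutoff_mul hΩ.measurableSet (hG i).1 ((hG i).2 j).1 hζ
  have hS := hρ.memLp_stress hH
  obtain ⟨M, δ, hδ, hM⟩ := exists_l2norm_increment_le hU (S := fun i j x => stress ρ (H x) i j)
    (H := fun i j x => H x i j) (sub_pos.2 hγ1) hS hH
    (fun x y => hρ.stress_monotone (H x) (H y))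
    (fun i φ hφ => sum_integral_stress_mul_eq_zero hEL hUΩ hHG hS i hφ)
    (fun i => exists_smooth_approx hζ.2.1.mul_right (hH i) (hw i))
    (⟨hη.1, hη.2.1, hηU⟩ : IsTestFunction U η)
  have hVΩ' : V ⊆ Ω := subset_closure.trans hVΩ
  have hmono : volume.restrict V ≤ volume.restrict Ω := Measure.restrict_mono hVΩ' le_rfl
  intro i
  refine ⟨(hG i).1.mono_measure hmono, fun j => ⟨fun x => G x i j, ((hG i).2 j).2.mono hVΩ',
    ((hG i).2 j).1.mono_measure hmono, fun k => ?_⟩⟩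
  obtain ⟨g, hg, -, hgl, hgw⟩ := exists_hasWeakPartial_of_increment_le (V := V) (hH i j)
    (hη.mono (subset_univ Ω)) hδ (fun h hh => hM i j k h hh) hηV
  refine ⟨g, ⟨((hG i).2 j).2.2.1.mono_set hVΩ', hgl, fun φ hφ => ?_⟩, hg.restrict V⟩
  rw [← hgw φ hφ]
  exact setIntegral_congr_fun hV.measurableSet fun x hx => by simp only [hHG x (hVU hx)]
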